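/- All graphs are finite, simple and undirected. For a fixed graph $H$, the problem \emph{$H$-free Edge Deletion} asks, given a graph $G$ and an integer $k\ge 0$ (the parameter), whether there is a set $F\subseteq E(G)$ with $|F|\le k$ such that $G-F$ has no induced subgraph isomorphic to $H$. A \emph{linear parameterized reduction} from a parameterized problem $A$ to a parameterized problem $B$ is an algorithm that maps every instance $(G,k)$ of $A$ to an instance $(G',k')$ of $B$ such that $(G,k)$ is a yes-instance of $A$ if and only if $(G',k')$ is a yes-instance of $B$, that runs in time polynomial in $|V(G)|+|E(G)|+k$, and for which there is a constant $c$, independent of the instance, with $k'\le c\,k$. \textbf{Lemma.} Let $H$ be a graph that has a connected component with at least two edges, and let $H_1$ be a connected component of $H$ with the maximum number of vertices. Then there is a linear parameterized reduction from $H_1$-free Edge Deletion to $H$-free Edge Deletion. -/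

import Mathlib

/-- An instance `(G, k)` of a graph problem parameterized by a natural number: a finite simple
graph `G` with vertex set `{0, …, n - 1}` and the parameter `k`. -/
structure GraphInstance where
  n : ℕ
  G : SimpleGraph (Fin n)
  k : ℕ

namespace GraphInstance

open Classical in
/-- The row of the vertex `j` in the lower triangle of the adjacency matrix of `G`: the bits
telling whether `j` is adjacent to `0, …, j - 1`, followed by the end-of-row symbol `none`. -/
noncomputable def row {n : ℕ} (G : SimpleGraph (Fin n)) (j : Fin n) : List (Option Bool) :=
  (List.ofFn fun i : Fin j.val => some (decide (G.Adj ⟨i.val, i.isLt.trans j.isLt⟩ j))) ++ [none]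

/-- The string encoding an instance `(G, k)`: the lower triangle of the adjacency matrix of `G`,
row by row, followed by `k` written in unary. -/
noncomputable def encode (I : GraphInstance) : List (Option Bool) :=
  (List.ofFn (row I.G)).flatten ++ List.replicate I.k (some true)

end GraphInstance

/-- `f` is computable in polynomial time, in the length of the encoded input, by a (multi-stack)
Turing machine with finitely many stacks, states and symbols. -/
def PolyTimeComputable (f : GraphInstance → GraphInstance) : Prop :=
  ∃ M : Turing.TM2ComputableInPolyTime GraphInstance.encode GraphInstance.encode f,
    ∀ s : M.tm.K, Finite (M.tm.Γ s)

/-- A linear parameterized reduction from `A` to `B` (problems are given by their sets of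
yes-instances): a polynomial-time many-one reduction `(G, k) ↦ (G', k')` with `k' = O(k)`. -/
def LinearParameterizedReduction (A B : Set GraphInstance) : Prop :=
  ∃ f : GraphInstance → GraphInstance,
    PolyTimeComputable f ∧ (∀ I, I ∈ A ↔ f I ∈ B) ∧ ∃ c : ℕ, ∀ I, (f I).k ≤ c * I.k

/-- The problem `H`-free Edge Deletion: can one delete at most `k` edges of `G` such that the
remaining graph has no induced subgraph isomorphic to `H`? -/
def FreeEdgeDeletion {V : Type*} (H : SimpleGraph V) : Set GraphInstance :=
  {I | ∃ F : Finset (Sym2 (Fin I.n)), (F : Set (Sym2 (Fin I.n))) ⊆ I.G.edgeSet ∧ F.card ≤ I.k ∧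
    ¬ H.IsIndContained (I.G.deleteEdges F)}

/-!
The reduction leaves the parameter `k` unchanged and adds to `G` a gadget graph with `k + 1` blocks,
each of which is a copy of `H` without its component `H₁`. For every component isomorphic to `H₁`,
its copies in the distinct blocks are joined completely to one another; otherwise there are no edges
between blocks (`SimpleGraph.blockGraph`).

A deletion of at most `k` edges leaves some block intact. Together with an induced copy of `H₁` in
what remains of `G`, this block is an induced copy of `H` (`SimpleGraph.isIndContained_of_block`).
Hence a solution of the new instance restricts to a solution of the given one.

Conversely, if a deletion destroys all induced copies of `H₁` in `G`, it suffices that no induced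
copy of `H` is left in the union with the untouched gadget graph
(`SimpleGraph.not_isIndContained_sum_blockGraph`). In such a copy, the components of `H` isomorphic
to `H₁` would all lie in the gadget graph, each over a single component of `H` other than `H₁`. As
`H₁` has the maximum number of vertices, the latter component is isomorphic to `H₁` too. By the
pigeonhole principle two of them lie over the same component `D`. In the join of the copies of `D`,
two sets of vertices without edges between them lie within the same copy of `D`, which has only half
as many vertices as needed.

The new rows of the adjacency matrix are periodic: the row of the vertex `u` of the block `i` is a
word of zeros, `i` copies of a word that depends only on `u`, and another such word. So a machine
with a counter for the number of vertices and one for the number of blocks writes the output in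
quadratic time (`BlockAppender.polyTimeComputable`).
-/

/-! ### A Turing machine appending blocks of rows -/

namespace BlockAppender

open Turing TM2.Stmt

/-- The symbols occurring in the encoding of an instance. -/
abbrev Letter := Option Bool

/-- The stacks of the machine: input, output, the reversed input (later without its unary tail),
two unary counters (of the rows read, and of the blocks that remain to be written), and a spare stack that
holds a counter while it is traversed. -/
inductive Stack
  | inp | out | text | rows | blocks | spare
  deriving DecidableEq

instance : Fintype Stack where
  elems := {.inp, .out, .text, .rows, .blocks, .spare}
  complete s := by cases s <;> decide

/-- The labels of the machine that appends blocks of `b` rows. The index of `next` is the number of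
rows of the current block that remain to be written, and that of the labels in the traversals of the
counters is the number of the row being written. -/
inductive Label (b : ℕ)
  | read | tail | next (u : Fin (b + 1))
  | blocks (u : Fin b) | blocksBack (u : Fin b) | rows (u : Fin b) | rowsBack (u : Fin b)
  | copy | clean
  deriving Fintype

/-- The statements of the machine, whose internal state holds the result of the last `pop` or
`peek`. -/
abbrev Stm (b : ℕ) := TM2.Stmt (fun _ : Stack => Letter) (Label b) (Option Letter)

/-- The configurations of the machine. -/
abbrev Conf (b : ℕ) := TM2.Cfg (fun _ : Stack => Letter) (Label b) (Option Letter)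

/-- Push the word `w` onto the stack `s`, its first letter ending up on top. -/
def pushWord {b : ℕ} (s : Stack) : List Letter → Stm b → Stm b
  | [], q => q
  | a :: w, q => pushWord s w (push s (fun _ => a) q)

/-- Pop the stack `s`; continue with `q` if there was a symbol to pop, and with `q'` otherwise. -/
def popElse {b : ℕ} (s : Stack) (q q' : Stm b) : Stm b :=
  pop s (fun _ a => a) (branch Option.isSome q q')

/-- The program. It builds the output from its end, since the first symbol has to come out on top:
the unary tail, then the rows of the new blocks, the last one first, and finally the rows of the
input. The row `u` of the block `i` consists of a `false` for each row of the input, `i` copies of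
`pat u`, `ini u`, and the end-of-row symbol. -/
def program {b : ℕ} (pat ini : Fin b → List Letter) : Label b → Stm b
  | .read => popElse .inp
      (push .text (fun a => a.getD none) <| branch (· == some none)
        (push .rows (fun _ => none) <| goto fun _ => .read) (goto fun _ => .read))
      (goto fun _ => .tail)
  | .tail => peek .text (fun _ a => a) <| branch (· == some (some true))
      (pop .text (fun a _ => a) <| push .blocks (fun _ => none) <| pushWord .out [some true] <|
        goto fun _ => .tail)
      (goto fun _ => .next (Fin.last b))
  | .next u => u.cases
      (popElse .blocks (goto fun _ => .next (Fin.last b)) (goto fun _ => .copy))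
      fun u => pushWord .out (ini u ++ [none]) <| goto fun _ => .blocks u
  | .blocks u => popElse .blocks
      (push .spare (fun _ => none) <| pushWord .out (pat u) <| goto fun _ => .blocks u)
      (goto fun _ => .blocksBack u)
  | .blocksBack u => popElse .spare
      (push .blocks (fun _ => none) <| goto fun _ => .blocksBack u) (goto fun _ => .rows u)
  | .rows u => popElse .rows
      (push .spare (fun _ => none) <| pushWord .out [some false] <| goto fun _ => .rows u)
      (goto fun _ => .rowsBack u)
  | .rowsBack u => popElse .spare
      (push .rows (fun _ => none) <| goto fun _ => .rowsBack u) (goto fun _ => .next u.castSucc)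
  | .copy => popElse .text
      (push .out (fun a => a.getD none) <| goto fun _ => .copy) (goto fun _ => .clean)
  | .clean => popElse .rows (goto fun _ => .clean) halt

/-- The machine running `program`. -/
abbrev machine {b : ℕ} (pat ini : Fin b → List Letter) : FinTM2 where
  K := Stack
  k₀ := .inp
  k₁ := .out
  Γ _ := Letter
  Λ := Label b
  main := .read
  σ := Option Letter
  initialState := none
  m := program pat ini

/-- The contents of the stacks, `n`, `i` and `j` being the values of the three counters. -/
def contents (inp out text : List Letter) (n i j : ℕ) : Stack → List Letter
  | .inp => inp
  | .out => out
  | .text => text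
  | .rows => List.replicate n none
  | .blocks => List.replicate i none
  | .spare => List.replicate j none

section contents

variable (inp out text w : List Letter) (n i j : ℕ)

@[simp] theorem update_inp : Function.update (contents inp out text n i j) .inp w =
    contents w out text n i j := by
  funext s; cases s <;> rfl

@[simp] theorem update_out : Function.update (contents inp out text n i j) .out w =
    contents inp w text n i j := by
  funext s; cases s <;> rfl

@[simp] theorem update_text : Function.update (contents inp out text n i j) .text w =
    contents inp out w n i j := by
  funext s; cases s <;> rfl

@[simp] theorem update_rows (m : ℕ) :
    Function.update (contents inp out text n i j) .rows (List.replicate m none) =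
      contents inp out text m i j := by
  funext s; cases s <;> rfl

@[simp] theorem update_blocks (m : ℕ) :
    Function.update (contents inp out text n i j) .blocks (List.replicate m none) =
      contents inp out text n m j := by
  funext s; cases s <;> rfl

@[simp] theorem update_spare (m : ℕ) :
    Function.update (contents inp out text n i j) .spare (List.replicate m none) =
      contents inp out text n i m := by
  funext s; cases s <;> rfl

end contents

@[simp] theorem stepAux_pushWord {b : ℕ} (s : Stack) (w : List Letter) (q : Stm b) (v : Option Letter)
    (S : Stack → List Letter) : TM2.stepAux (pushWord s w q) v S =
      TM2.stepAux q v (Function.update S s (w ++ S s)) := by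
  induction w generalizing q with
  | nil => simp [pushWord]
  | cons a w ih => simp [pushWord, ih]

/-- `f` leads from `a` to `c` in at most `t` steps. -/
def ReachesIn {α : Type*} (f : α → Option α) (t : ℕ) (a c : α) : Prop :=
  Nonempty (StateTransition.EvalsToInTime f a (some c) t)

namespace ReachesIn

variable {α : Type*} {f : α → Option α} {t t' : ℕ} {a c d : α}

theorem refl (f : α → Option α) (t : ℕ) (a : α) : ReachesIn f t a a :=
  ⟨⟨.refl f a, t.zero_le⟩⟩

theorem trans (h : ReachesIn f t a c) (h' : ReachesIn f t' c d) : ReachesIn f (t + t') a d :=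
  ⟨add_comm t t' ▸ .trans f _ _ _ _ _ h.some h'.some⟩

theorem mono (h : ReachesIn f t a c) (ht : t ≤ t') : ReachesIn f t' a c :=
  ⟨⟨h.some.toEvalsTo, h.some.steps_le_m.trans ht⟩⟩

theorem head (h : f a = some c) (h' : ReachesIn f t c d) : ReachesIn f (t + 1) a d :=
  add_comm 1 t ▸ trans ⟨⟨⟨1, by simpa [flip] using h⟩, le_rfl⟩⟩ h'

theorem single (h : f a = some c) : ReachesIn f 1 a c :=
  head h (refl f 0 c)

end ReachesIn

section run

variable {b : ℕ} (pat ini : Fin b → List Letter)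

/-- The program leads from one configuration to another in at most `t` steps. -/
abbrev Runs (t : ℕ) (c d : Conf b) : Prop := ReachesIn (TM2.step (program pat ini)) t c d

variable (out text : List Letter) (n i j : ℕ) (v : Option Letter)

theorem runs_read (inp : List Letter) :
    Runs pat ini (inp.length + 1) ⟨some .read, v, contents inp out text n 0 0⟩
      ⟨some .tail, none, contents [] out (inp.reverse ++ text) (n + inp.count none) 0 0⟩ := by
  induction inp generalizing text n v with
  | nil => exact .single (by simp [program, popElse, contents])
  | cons a inp ih =>
    rcases a with _ | a
    · refine .head ?_ (by simpa [add_assoc, add_comm 1] using ih (none :: text) (n + 1) (some none))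
      simp [program, popElse, contents, ← List.replicate_succ]
    · refine .head ?_ (by simpa using ih (some a :: text) n (some (some a)))
      simp [program, popElse, contents]

theorem runs_tail (k : ℕ) (htext : text.head? ≠ some (some true)) :
    Runs pat ini (k + 1)
      ⟨some .tail, v, contents [] out (List.replicate k (some true) ++ text) n i 0⟩
      ⟨some (.next (Fin.last b)), text.head?,
        contents [] (List.replicate k (some true) ++ out) text n (i + k) 0⟩ := by
  induction k generalizing out i v with
  | zero => exact .single (by simp [program, contents, beq_eq_false_iff_ne.2 htext])
  | succ k ih =>
    refine .head ?_ (by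
      simpa [add_assoc, add_comm 1, List.replicate_succ'] using
        ih (some true :: out) (i + 1) (some (some true)))
    simp [program, contents, ← List.replicate_succ, List.head?_replicate]

theorem runs_blocks (u : Fin b) :
    Runs pat ini (i + 1) ⟨some (.blocks u), v, contents [] out text n i j⟩
      ⟨some (.blocksBack u), none,
        contents [] ((List.replicate i (pat u)).flatten ++ out) text n 0 (j + i)⟩ := by
  induction i generalizing out j v with
  | zero => exact .single (by simp [program, popElse, contents])
  | succ i ih =>
    refine .head ?_ (by
      simpa [add_assoc, add_comm 1, List.replicate_succ'] using
        ih (pat u ++ out) (j + 1) (some none))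
    simp [program, popElse, contents, ← List.replicate_succ, List.head?_replicate]

theorem runs_blocksBack (u : Fin b) :
    Runs pat ini (j + 1) ⟨some (.blocksBack u), v, contents [] out text n i j⟩
      ⟨some (.rows u), none, contents [] out text n (i + j) 0⟩ := by
  induction j generalizing i v with
  | zero => exact .single (by simp [program, popElse, contents])
  | succ j ih =>
    refine .head ?_ (by simpa [add_assoc, add_comm 1] using ih (i + 1) (some none))
    simp [program, popElse, contents, ← List.replicate_succ, List.head?_replicate]

theorem runs_rows (u : Fin b) :
    Runs pat ini (n + 1) ⟨some (.rows u), v, contents [] out text n i j⟩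
      ⟨some (.rowsBack u), none,
        contents [] (List.replicate n (some false) ++ out) text 0 i (j + n)⟩ := by
  induction n generalizing out j v with
  | zero => exact .single (by simp [program, popElse, contents])
  | succ n ih =>
    refine .head ?_ (by
      simpa [add_assoc, add_comm 1, List.replicate_succ'] using
        ih (some false :: out) (j + 1) (some none))
    simp [program, popElse, contents, ← List.replicate_succ, List.head?_replicate]

theorem runs_rowsBack (u : Fin b) :
    Runs pat ini (j + 1) ⟨some (.rowsBack u), v, contents [] out text n i j⟩
      ⟨some (.next u.castSucc), none, contents [] out text (n + j) i 0⟩ := by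
  induction j generalizing n v with
  | zero => exact .single (by simp [program, popElse, contents])
  | succ j ih =>
    refine .head ?_ (by simpa [add_assoc, add_comm 1] using ih (n + 1) (some none))
    simp [program, popElse, contents, ← List.replicate_succ, List.head?_replicate]

theorem runs_copy :
    Runs pat ini (text.length + 1) ⟨some .copy, v, contents [] out text n i j⟩
      ⟨some .clean, none, contents [] (text.reverse ++ out) [] n i j⟩ := by
  induction text generalizing out v with
  | nil => exact .single (by simp [program, popElse, contents])
  | cons a text ih =>
    refine .head ?_ (by simpa using ih (a :: out) (some a))
    simp [program, popElse, contents]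

theorem runs_clean :
    Runs pat ini (n + 1) ⟨some .clean, v, contents [] out text n i j⟩
      ⟨none, none, contents [] out text 0 i j⟩ := by
  induction n generalizing v with
  | zero => exact .single (by simp [program, popElse, contents])
  | succ n ih =>
    refine .head ?_ (ih (some none))
    simp [program, popElse, contents, List.head?_replicate]

/-- The row `u` of the block `i`, written below `n` rows of the input. -/
def rowWord (u : Fin b) : List Letter :=
  List.replicate n (some false) ++ (List.replicate i (pat u)).flatten ++ ini u ++ [none]

/-- The rows of the block `i`. -/
def blockWord : List Letter :=
  (List.ofFn fun u => rowWord pat ini n i u).flatten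

/-- The rows of the first `k` blocks. -/
def blocksWord (k : ℕ) : List Letter :=
  (List.ofFn fun i : Fin k => blockWord pat ini n i).flatten

theorem runs_row (u : Fin b) :
    Runs pat ini (2 * i + 2 * n + 5) ⟨some (.next u.succ), v, contents [] out text n i 0⟩
      ⟨some (.next u.castSucc), none,
        contents [] (rowWord pat ini n i u ++ out) text n i 0⟩ := by
  have h₁ := (runs_blocks pat ini (ini u ++ none :: out) text n i 0 v u).trans
    (runs_blocksBack pat ini _ text n 0 (0 + i) none u)
  have h₂ := (runs_rows pat ini ((List.replicate i (pat u)).flatten ++ (ini u ++ none :: out))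
    text n i 0 none u).trans (runs_rowsBack pat ini _ text 0 i (0 + n) none u)
  simp only [zero_add] at h₁ h₂
  refine (ReachesIn.head (t := i + 1 + (i + 1) + (n + 1 + (n + 1)))
    (c := ⟨some (.blocks u), v, contents [] (ini u ++ none :: out) text n i 0⟩)
    (by simp [program, contents]) ?_).mono (by omega)
  simpa [rowWord] using h₁.trans h₂

theorem runs_block (u : ℕ) (hu : u < b + 1) :
    Runs pat ini (u * (2 * i + 2 * n + 5)) ⟨some (.next ⟨u, hu⟩), v, contents [] out text n i 0⟩
      ⟨some (.next 0), if u = 0 then v else none,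
        contents [] ((List.ofFn fun x : Fin u =>
          rowWord pat ini n i (x.castLE (Nat.le_of_lt_succ hu))).flatten ++ out) text n i 0⟩ := by
  induction u generalizing out v with
  | zero => simpa using ReachesIn.refl _ _ _
  | succ u ih =>
    have h := (runs_row pat ini out text n i v ⟨u, by omega⟩).trans
      (ih (rowWord pat ini n i ⟨u, by omega⟩ ++ out) none (by omega))
    refine ReachesIn.mono (t := 2 * i + 2 * n + 5 + u * (2 * i + 2 * n + 5)) ?_
      (by rw [add_one_mul, add_comm])
    have hlast : (Fin.last u).castLE (Nat.le_of_lt_succ hu) = ⟨u, by omega⟩ := rfl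
    simpa [List.ofFn_succ', -List.ofFn_succ, hlast] using h

theorem runs_allBlocks :
    Runs pat ini ((i + 1) * (b * (2 * i + 2 * n + 5) + 1))
      ⟨some (.next (Fin.last b)), v, contents [] out text n i 0⟩
      ⟨some .copy, none, contents [] (blocksWord pat ini n (i + 1) ++ out) text n 0 0⟩ := by
  induction i generalizing out v with
  | zero =>
    refine ((runs_block pat ini out text n 0 v b (by omega)).trans (.single ?_)).mono (by simp)
    simp [program, popElse, contents, blocksWord, blockWord]
  | succ i ih =>
    refine ((runs_block pat ini out text n (i + 1) v b (by omega)).trans (.head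
      (c := ⟨some (.next (Fin.last b)), some none,
        contents [] (blockWord pat ini n (i + 1) ++ out) text n i 0⟩)
      (t := (i + 1) * (b * (2 * i + 2 * n + 5) + 1)) ?_ ?_)).mono ?_
    · simp [program, popElse, contents, blockWord, List.head?_replicate]
    · simpa [blocksWord, List.ofFn_succ', -List.ofFn_succ] using
        ih (blockWord pat ini n (i + 1) ++ out) (some none)
    · have : (i + 1) * (b * (2 * i + 2 * n + 5) + 1) ≤
          (i + 1) * (b * (2 * (i + 1) + 2 * n + 5) + 1) := by gcongr; omega
      linarith

/-- The effect of the machine on the encoding of an instance, of which `text` are the rows. -/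
theorem runs_program (k : ℕ) (htext : text.getLast? ≠ some (some true)) (t : ℕ)
    (ht : t = (text ++ List.replicate k (some true)).length) :
    Runs pat ini ((t + 1) * (b * (4 * t + 5) + 5))
      ⟨some .read, none, contents (text ++ List.replicate k (some true)) [] [] 0 0 0⟩
      ⟨none, none, contents [] (text ++ blocksWord pat ini (text.count none) (k + 1) ++
        List.replicate k (some true)) [] 0 0 0⟩ := by
  set n := text.count none with hn
  have hnt : n ≤ text.length := List.count_le_length
  have h₁ := runs_read pat ini [] [] 0 none (text ++ List.replicate k (some true))
  have h₂ := runs_tail pat ini [] text.reverse n 0 none k (by simpa using htext)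
  have h₃ := runs_allBlocks pat ini (List.replicate k (some true)) text.reverse n k
    text.reverse.head?
  have h₄ := runs_copy pat ini (blocksWord pat ini n (k + 1) ++ List.replicate k (some true))
    text.reverse n 0 0 none
  have h₅ := runs_clean pat ini (text ++ (blocksWord pat ini n (k + 1) ++
    List.replicate k (some true))) [] n 0 0 none
  simp only [List.reverse_append, List.reverse_replicate, List.append_nil, zero_add,
    List.count_append, List.count_replicate, ← hn, List.reverse_reverse] at h₁ h₂ h₃ h₄ h₅
  simp only [List.length_append, List.length_replicate] at ht
  -- For input length `t`, the two unary counters are at most `t` throughout.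
  refine ((((h₁.trans h₂).trans h₃).trans h₄).trans h₅).mono ?_ |> fun h => by simpa using h
  simp only [List.length_append, List.length_replicate, List.length_reverse]
  have h : (k + 1) * (b * (2 * k + 2 * n + 5) + 1) ≤ (t + 1) * (b * (4 * t + 5) + 1) := by
    gcongr ?_ * (b * ?_ + 1) <;> omega
  linarith

end run

/-- A function that, on encodings, keeps the rows of the given instance and its parameter `k` and
appends `k + 1` blocks of rows to the former, is computable in polynomial time. -/
theorem polyTimeComputable {b : ℕ} (pat ini : Fin b → List Letter)
    (f : GraphInstance → GraphInstance)
    (text : GraphInstance → List Letter)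
    (htext : ∀ I, (text I).getLast? ≠ some (some true))
    (hI : ∀ I, I.encode = text I ++ List.replicate I.k (some true))
    (hf : ∀ I, (f I).encode = text I ++ blocksWord pat ini ((text I).count none) (I.k + 1) ++
      List.replicate I.k (some true)) :
    PolyTimeComputable f := by
  refine ⟨⟨⟨machine pat ini, Equiv.refl _, Equiv.refl _⟩,
    (.X + 1) * (b * (4 * .X + 5) + 5), fun I => ?_⟩, fun _ => (inferInstance : Finite Letter)⟩
  have h := runs_program pat ini (text I) I.k (htext I) _ rfl
  rw [← hI, ← hf] at h
  have hi : initList (machine pat ini) I.encode =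
      ⟨some .read, none, contents I.encode [] [] 0 0 0⟩ := by
    unfold initList
    congr 1
    funext s; cases s <;> rfl
  have ho : haltList (machine pat ini) (f I).encode =
      ⟨none, none, contents [] (f I).encode [] 0 0 0⟩ := by
    unfold haltList
    congr 1
    funext s; cases s <;> rfl
  rw [← hi, ← ho] at h
  suffices TM2OutputsInTime (machine pat ini) I.encode (some (f I).encode)
      ((I.encode.length + 1) * (b * (4 * I.encode.length + 5) + 5)) by simpa using this
  exact h.some

end BlockAppender

/-! ### The gadget graph -/

namespace SimpleGraph

variable {V : Type*} {H : SimpleGraph V} (C₁ : H.ConnectedComponent)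

/-- The component `C` is isomorphic to `C₁`. -/
def ConnectedComponent.IsTwin (C : H.ConnectedComponent) : Prop :=
  Nonempty (C.toSimpleGraph ≃g C₁.toSimpleGraph)

/-- The gadget graph with `m` blocks, each of which is a copy of `H` without its component `C₁`.
For each component isomorphic to `C₁`, the copies of it in the distinct blocks are joined completely
to one another; there are no other edges between distinct blocks. -/
def blockGraph (m : ℕ) : SimpleGraph (Fin m × ↥C₁.suppᶜ) where
  Adj x y := (x.1 = y.1 ∧ H.Adj x.2 y.2) ∨
    (x.1 ≠ y.1 ∧ H.connectedComponentMk x.2 = H.connectedComponentMk y.2 ∧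
      C₁.IsTwin (H.connectedComponentMk x.2))
  symm := ⟨by
    rintro x y (⟨h, h'⟩ | ⟨h, h', h''⟩)
    · exact .inl ⟨h.symm, h'.symm⟩
    · exact .inr ⟨h.symm, h'.symm, h' ▸ h''⟩⟩
  loopless := ⟨fun x => by simp⟩

variable {C₁}

theorem blockGraph_adj_same {m : ℕ} {i : Fin m} {u v : ↥C₁.suppᶜ} :
    (blockGraph C₁ m).Adj (i, u) (i, v) ↔ H.Adj u v := by
  simp [blockGraph]

theorem blockGraph_adj_of_ne {m : ℕ} {i j : Fin m} (hij : i ≠ j) {u v : ↥C₁.suppᶜ} :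
    (blockGraph C₁ m).Adj (i, u) (j, v) ↔
      H.connectedComponentMk u = H.connectedComponentMk v ∧
        C₁.IsTwin (H.connectedComponentMk u) := by
  simp [blockGraph, hij]

theorem connectedComponentMk_eq_of_blockGraph_adj {m : ℕ} {x y : Fin m × ↥C₁.suppᶜ}
    (h : (blockGraph C₁ m).Adj x y) :
    H.connectedComponentMk x.2 = H.connectedComponentMk y.2 := by
  rcases h with h | h
  · exact ConnectedComponent.sound h.2.reachable
  · exact h.2.1

/-- A function that is constant along edges is constant on components. -/
theorem Reachable.apply_eq {α β : Type*} {G : SimpleGraph α} {f : α → β} {u v : α}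
    (h : G.Reachable u v) (hf : ∀ x y, G.Adj x y → f x = f y) : f u = f v := by
  obtain ⟨p⟩ := h
  induction p with
  | nil => rfl
  | cons hadj p ih => exact (hf _ _ hadj).trans ih

/-- An induced copy of `C₁` in `G`, together with a block that has lost no edge, is an induced copy
of `H`. -/
theorem isIndContained_of_block {X : Type*} {m : ℕ} {G : SimpleGraph X}
    {K : SimpleGraph (X ⊕ Fin m × ↥C₁.suppᶜ)} (hG : C₁.toSimpleGraph.IsIndContained G)
    (hK : ∀ a b, K.Adj (.inl a) (.inl b) ↔ G.Adj a b) (hK' : ∀ a x, ¬ K.Adj (.inl a) (.inr x))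
    (i : Fin m) (hi : ∀ u v, K.Adj (.inr (i, u)) (.inr (i, v)) ↔ H.Adj u v) :
    H.IsIndContained K := by
  classical
  obtain ⟨φ⟩ := hG
  have hsep : ∀ {u v}, u ∈ C₁.supp → v ∉ C₁.supp → ¬ H.Adj u v := fun hu hv h =>
    hv ((C₁.mem_supp_congr_adj h).1 hu)
  let g : V → X ⊕ Fin m × ↥C₁.suppᶜ := fun v =>
    if h : v ∈ C₁.supp then .inl (φ ⟨v, h⟩) else .inr (i, ⟨v, h⟩)
  have hg : ∀ {v} (h : v ∈ C₁.supp), g v = .inl (φ ⟨v, h⟩) := fun h => dif_pos h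
  have hg' : ∀ {v} (h : v ∉ C₁.supp), g v = .inr (i, ⟨v, h⟩) := fun h => dif_neg h
  refine ⟨⟨⟨g, fun u v huv => ?_⟩, fun {u v} => ?_⟩⟩
  · by_cases hu : u ∈ C₁.supp <;> by_cases hv : v ∈ C₁.supp
    · rw [hg hu, hg hv] at huv
      exact congrArg Subtype.val (φ.injective (Sum.inl_injective huv))
    · simp [hg hu, hg' hv] at huv
    · simp [hg' hu, hg hv] at huv
    · simpa [hg' hu, hg' hv] using huv
  · change K.Adj (g u) (g v) ↔ _
    by_cases hu : u ∈ C₁.supp <;> by_cases hv : v ∈ C₁.supp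
    · rw [hg hu, hg hv, hK, φ.map_adj_iff]
      rfl
    · rw [hg hu, hg' hv]
      exact iff_of_false (hK' _ _) (hsep hu hv)
    · rw [hg' hu, hg hv, K.adj_comm, H.adj_comm]
      exact iff_of_false (hK' _ _) (hsep hv hu)
    · rw [hg' hu, hg' hv, hi]

/-- An induced copy of `H` in the disjoint union of `G` and the gadget graph needs a copy of `C₁` in
`G`. Otherwise each component of `H` isomorphic to `C₁` lies over such a component in the gadget
graph, other than `C₁` itself. Two of them then lie over the same one, and, having no edges between
them, within a single block, where there are too few vertices for that. -/
theorem not_isIndContained_sum_blockGraph [Finite V] {X : Type*} {G : SimpleGraph X} (m : ℕ)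
    (hC₁ : ∀ C : H.ConnectedComponent, C.supp.ncard ≤ C₁.supp.ncard)
    (hG : ¬ C₁.toSimpleGraph.IsIndContained G) :
    ¬ H.IsIndContained (G ⊕g blockGraph C₁ m) := by
  rintro ⟨ψ⟩
  -- The component of `H` over which the image of a vertex lies, or `none` if it is in `G`.
  let f : V → Option H.ConnectedComponent := fun v =>
    (ψ v).elim (fun _ => none) fun x => some (H.connectedComponentMk x.2)
  have hf : ∀ {u v}, H.Reachable u v → f u = f v := fun h => h.apply_eq fun x y hxy => by
    have := ψ.map_adj_iff.2 hxy
    simp only [f]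
    rcases hx : ψ x with a | a <;> rcases hy : ψ y with b | b <;> rw [hx, hy] at this
    · rfl
    · simp at this
    · simp at this
    · simpa using connectedComponentMk_eq_of_blockGraph_adj (sum_adj_inr.1 this)
  have hcard : ∀ {C : H.ConnectedComponent}, C₁.IsTwin C → C.supp.ncard = C₁.supp.ncard :=
    fun ⟨e⟩ => Set.ncard_congr' e.toEquiv
  -- The components isomorphic to `C₁` do not go into `G`, which has no copy of `C₁`.
  have hinr : ∀ v : {v // C₁.IsTwin (H.connectedComponentMk v)}, ∃ x, ψ v = .inr x := by
    rintro ⟨v, ⟨e⟩⟩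
    rcases hv : ψ v with a | x
    swap; · exact ⟨x, rfl⟩
    have hl : ∀ w : H.connectedComponentMk v, ∃ a, ψ w = .inl a := fun w => by
      have := hf (ConnectedComponent.exact w.2)
      rcases hw : ψ w with b | y
      · exact ⟨b, rfl⟩
      · simp [f, hv, hw] at this
    choose g hg using hl
    have hginj : Function.Injective g := fun a b hab =>
      Subtype.ext (ψ.injective (by rw [hg, hg, hab]))
    refine absurd ⟨e.symm.toRelEmbedding.trans (RelEmbedding.mk ⟨g, hginj⟩ ?_ :
      (H.connectedComponentMk v).toSimpleGraph ↪g G)⟩ hG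
    · intro a b
      have := ψ.map_adj_iff (v := a.1) (w := b.1)
      rw [hg, hg, sum_adj_inl] at this
      exact this
  choose x hx using hinr
  have hfx : ∀ v : {v // C₁.IsTwin (H.connectedComponentMk v)},
      f v = some (H.connectedComponentMk (x v).2) := fun v => by simp [f, hx]
  have hxinj : ∀ v w, x v = x w → v = w := fun v w h =>
    Subtype.ext (ψ.injective (by rw [hx, hx, h]))
  have hxadj : ∀ v w, (blockGraph C₁ m).Adj (x v) (x w) ↔ H.Adj v w := fun v w => by
    rw [← ψ.map_adj_iff, hx, hx, sum_adj_inr]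
  have hne : ∀ v, H.connectedComponentMk (x v).2 ≠ C₁ := fun v => (x v).2.2
  -- Over a component that is not isomorphic to `C₁` there are no edges between distinct blocks. So a
  -- copy of `C₁` there would lie in one block and, by maximality, fill the component.
  have htwin : ∀ v, C₁.IsTwin (H.connectedComponentMk (x v).2) := by
    intro v
    by_contra hv
    have hcomp : ∀ w : H.connectedComponentMk v.1,
        H.connectedComponentMk w.1 = H.connectedComponentMk v.1 := fun w => w.2
    let y : H.connectedComponentMk v.1 → Fin m × ↥C₁.suppᶜ := fun w =>
      x ⟨w, by rw [hcomp]; exact v.2⟩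
    have hy : ∀ w, H.connectedComponentMk (y w).2 = H.connectedComponentMk (x v).2 := fun w =>
      Option.some_injective _ <| by
        rw [← hfx, ← hfx]; exact hf (ConnectedComponent.exact w.2)
    have hyadj : ∀ a b, (blockGraph C₁ m).Adj (y a) (y b) ↔
        (H.connectedComponentMk v.1).toSimpleGraph.Adj a b := fun a b => hxadj _ _
    have hblock : ∀ a b, (y a).1 = (y b).1 := fun a b =>
      ((H.connectedComponentMk v.1).connected_toSimpleGraph.preconnected a b).apply_eq
        (f := fun w => (y w).1) fun c d hcd => by
          rcases (hyadj c d).2 hcd with h | h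
          · exact h.1
          · exact absurd (hy c ▸ h.2.2) hv
    let z : H.connectedComponentMk v.1 → H.connectedComponentMk (x v).2.1 := fun w =>
      ⟨(y w).2, hy w⟩
    have hz : Function.Injective z := fun a b hab => by
      have h := hxinj _ _ (Prod.ext (hblock a b)
        (Subtype.ext (congrArg (fun t => t.1) hab)))
      exact Subtype.ext (congrArg (fun t => t.1) h)
    have hzb : Function.Bijective z := by
      refine (Nat.bijective_iff_injective_and_card z).2 ⟨hz, le_antisymm
        (Nat.card_le_card_of_injective z hz) ?_⟩
      exact (hC₁ _).trans (hcard v.2).ge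
    obtain ⟨e⟩ := v.2
    refine hv ⟨(RelIso.mk (Equiv.ofBijective z hzb) ?_ :
      (H.connectedComponentMk v.1).toSimpleGraph ≃g _).symm.trans e⟩
    intro a b
    rw [← hyadj, ← Prod.mk.eta (p := y a), ← Prod.mk.eta (p := y b), hblock a b,
      blockGraph_adj_same]
    rfl
  -- Two components lie over the same one.
  obtain ⟨v, w, hvw, hD⟩ : ∃ v w, H.connectedComponentMk v.1 ≠ H.connectedComponentMk w.1 ∧
      H.connectedComponentMk (x v).2.1 = H.connectedComponentMk (x w).2.1 := by
    let r : {C // C₁.IsTwin C} → {v // C₁.IsTwin (H.connectedComponentMk v)} := fun C =>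
      ⟨C.1.out, by
        have : H.connectedComponentMk C.1.out = C.1 := C.1.out_eq
        rw [this]; exact C.2⟩
    have hr : ∀ C, H.connectedComponentMk (r C).1 = C.1 := fun C => C.1.out_eq
    let d : {C // C₁.IsTwin C} → {C // C₁.IsTwin C} := fun C => ⟨_, htwin (r C)⟩
    have hd : ¬ Function.Injective d := fun hd => by
      obtain ⟨C, hC⟩ := (Finite.injective_iff_surjective.1 hd) ⟨C₁, ⟨.refl⟩⟩
      exact hne _ (congrArg Subtype.val hC)
    simp only [Function.Injective, not_forall] at hd
    obtain ⟨C, C', h, hC⟩ := hd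
    exact ⟨r C, r C', by rw [hr, hr]; exact fun h => hC (Subtype.ext h), congrArg Subtype.val h⟩
  set D := H.connectedComponentMk (x v).2.1
  set C := H.connectedComponentMk v.1
  set C' := H.connectedComponentMk w.1
  have hmem : ∀ a : {v // C₁.IsTwin (H.connectedComponentMk v)},
      a.1 ∈ C.supp ∪ C'.supp → H.connectedComponentMk (x a).2.1 = D := by
    intro a ha
    apply Option.some_injective
    rcases ha with ha | ha
    · rw [← hfx, ← hfx]
      exact hf (ConnectedComponent.exact ha)
    · rw [hD, ← hfx, ← hfx]
      exact hf (ConnectedComponent.exact ha)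
  -- Over a component isomorphic to `C₁`, nonadjacent vertices lie in the same block.
  have hopp : ∀ a b, a.1 ∈ C.supp → b.1 ∈ C'.supp → (x a).1 = (x b).1 := by
    intro a b ha hb
    by_contra hab
    have h : (blockGraph C₁ m).Adj (x a) (x b) :=
      (blockGraph_adj_of_ne hab).2 ⟨(hmem a (.inl ha)).trans (hmem b (.inr hb)).symm, htwin a⟩
    rw [hxadj] at h
    exact hvw (by rw [← show _ = C from ha, ← show _ = C' from hb,
      ConnectedComponent.sound h.reachable])
  have hsame : ∀ a, a.1 ∈ C.supp ∪ C'.supp → (x a).1 = (x v).1 := by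
    rintro a (ha | ha)
    · exact (hopp a w ha rfl).trans (hopp v w rfl rfl).symm
    · exact (hopp v a rfl ha).symm
  have htw : ∀ a ∈ C.supp ∪ C'.supp, C₁.IsTwin (H.connectedComponentMk a) := by
    rintro a (ha | ha)
    · rw [show H.connectedComponentMk a = C from ha]; exact v.2
    · rw [show H.connectedComponentMk a = C' from ha]; exact w.2
  have hle : (C.supp ∪ C'.supp).ncard ≤ D.supp.ncard := by
    let z : ↥(C.supp ∪ C'.supp) → D.supp := fun a => ⟨(x ⟨a, htw a a.2⟩).2.1, hmem _ a.2⟩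
    refine Nat.card_le_card_of_injective z fun a b hab => ?_
    have h := hxinj _ _ (Prod.ext ((hsame ⟨a, htw a a.2⟩ a.2).trans
      (hsame ⟨b, htw b b.2⟩ b.2).symm) (Subtype.ext (congrArg (fun t => t.1) hab)))
    exact Subtype.ext (congrArg (fun t => t.1) h)
  rw [Set.ncard_union_eq (pairwise_disjoint_supp_connectedComponent H hvw)
    (Set.toFinite _) (Set.toFinite _), hcard v.2, hcard w.2] at hle
  have hpos : 0 < C₁.supp.ncard := (Set.ncard_pos (Set.toFinite _)).2 C₁.nonempty_supp
  have := hC₁ D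
  omega

end SimpleGraph

/-! ### The reduction -/

namespace GraphInstance

open SimpleGraph BlockAppender

variable {V : Type*} {H : SimpleGraph V} {C₁ : H.ConnectedComponent} {b : ℕ}
  (e : ↥C₁.suppᶜ ≃ Fin b)

/-- The numbering of the vertices of the padded graph: those of the given graph come first, then
those of the gadget graph, block by block. -/
def vertexEquiv (n m : ℕ) : Fin (n + m * b) ≃ Fin n ⊕ Fin m × ↥C₁.suppᶜ :=
  finSumFinEquiv.symm.trans ((Equiv.refl _).sumCongr
    (finProdFinEquiv.symm.trans ((Equiv.refl _).prodCongr e.symm)))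

theorem vertexEquiv_eq_inl {n m : ℕ} {x : Fin (n + m * b)} {i : Fin n} (h : x.val = i.val) :
    vertexEquiv e n m x = .inl i := by
  rw [← Equiv.eq_symm_apply]
  exact Fin.ext (by simp [vertexEquiv, h])

theorem vertexEquiv_eq_inr {n m : ℕ} {x : Fin (n + m * b)} {i : Fin m} {u : Fin b}
    (h : x.val = n + (i.val * b + u.val)) : vertexEquiv e n m x = .inr (i, e.symm u) := by
  rw [← Equiv.eq_symm_apply]
  exact Fin.ext (by simp [vertexEquiv, h]; ring)

/-- The graph of `I` together with the gadget graph with `k + 1` blocks, so that every deletion of at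
most `k` edges spares a block. -/
def padGraph (I : GraphInstance) : SimpleGraph (Fin (I.n + (I.k + 1) * b)) :=
  (I.G ⊕g blockGraph C₁ (I.k + 1)).comap (vertexEquiv e I.n (I.k + 1))

/-- The instance to which the reduction maps `I`. -/
def pad (I : GraphInstance) : GraphInstance :=
  ⟨I.n + (I.k + 1) * b, padGraph e I, I.k⟩

theorem padGraph_adj {I : GraphInstance} {x y : Fin (I.n + (I.k + 1) * b)}
    {x' y' : Fin I.n ⊕ Fin (I.k + 1) × ↥C₁.suppᶜ} (hx : vertexEquiv e I.n (I.k + 1) x = x')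
    (hy : vertexEquiv e I.n (I.k + 1) y = y') :
    (padGraph e I).Adj x y ↔ (I.G ⊕g blockGraph C₁ (I.k + 1)).Adj x' y' := by
  rw [← hx, ← hy]
  rfl

open Classical in
/-- The part of the row of the vertex `u` of the gadget graph that belongs to one of the preceding
blocks. -/
noncomputable def twinWord (u : Fin b) : List Letter :=
  List.ofFn fun v : Fin b => some (decide
    (H.connectedComponentMk (e.symm v) = H.connectedComponentMk (e.symm u) ∧
      C₁.IsTwin (H.connectedComponentMk (e.symm v))))

open Classical in
/-- The part of the row of the vertex `u` of the gadget graph that belongs to its own block. -/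
noncomputable def adjWord (u : Fin b) : List Letter :=
  List.ofFn fun v : Fin u => some (decide (H.Adj (e.symm (v.castLE u.2.le)) (e.symm u)))

theorem row_padGraph_left (I : GraphInstance) (j : Fin I.n) :
    row (padGraph e I) (j.castLE (Nat.le_add_right _ _)) = row I.G j := by
  unfold row
  congr 2
  funext i
  refine congrArg some (decide_eq_decide.2 ?_)
  exact padGraph_adj e (x' := .inl ⟨i.val, i.isLt.trans j.isLt⟩) (y' := .inl j)
    (vertexEquiv_eq_inl e rfl) (vertexEquiv_eq_inl e rfl)

theorem row_padGraph_right (I : GraphInstance) (i : Fin (I.k + 1)) (u : Fin b)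
    (h : i * b + u < (I.k + 1) * b) :
    row (padGraph e I) (Fin.natAdd I.n ⟨i * b + u, h⟩) =
      rowWord (twinWord e) (adjWord e) I.n i u := by
  have hj : vertexEquiv e I.n (I.k + 1) (Fin.natAdd I.n ⟨i * b + u, h⟩) = .inr (i, e.symm u) :=
    vertexEquiv_eq_inr e rfl
  classical
  unfold row rowWord
  congr 1
  change List.ofFn (n := I.n + (i * b + u)) _ = _
  rw [List.ofFn_add, List.ofFn_add, List.ofFn_mul, ← List.append_assoc]
  congr 1
  · congr 1
    · rw [← List.ofFn_const]
      congr 1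
      funext x
      refine congrArg some (decide_eq_false ?_)
      rw [padGraph_adj e (x' := .inl x) (vertexEquiv_eq_inl e rfl) hj]
      exact not_adj_sum_inl_inr _ _
    · rw [← List.ofFn_const]
      congr 2
      funext x
      unfold twinWord
      congr 1
      funext v
      have hx : x.val < I.k + 1 := x.2.trans i.2
      refine congrArg some (decide_eq_decide.2 ?_)
      rw [padGraph_adj e (x' := .inr (⟨x, hx⟩, e.symm v)) (vertexEquiv_eq_inr e rfl) hj,
        sum_adj_inr, blockGraph_adj_of_ne fun h => x.2.ne (congrArg Fin.val h)]
  · unfold adjWord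
    congr 1
    funext v
    refine congrArg some (decide_eq_decide.2 ?_)
    rw [padGraph_adj e (x' := .inr (i, e.symm (v.castLE u.2.le))) (vertexEquiv_eq_inr e rfl) hj,
      sum_adj_inr, blockGraph_adj_same]

theorem encode_pad (I : GraphInstance) : (pad e I).encode =
    (List.ofFn (row I.G)).flatten ++ blocksWord (twinWord e) (adjWord e) I.n (I.k + 1) ++
      List.replicate I.k (some true) := by
  change (List.ofFn (row (padGraph e I))).flatten ++ _ = _
  congr 1
  rw [List.ofFn_add, List.flatten_append, List.ofFn_mul]
  simp only [row_padGraph_left, row_padGraph_right]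
  congr 1
  simp [blocksWord, blockWord, List.flatten_flatten, List.map_ofFn, Function.comp_def]

theorem count_none_rows {n : ℕ} (G : SimpleGraph (Fin n)) :
    (List.ofFn (row G)).flatten.count none = n := by
  have h : ∀ j, (row G j).count none = 1 := fun j => by
    simp [row, List.count_eq_zero]
  simp [List.count_flatten, List.map_ofFn, Function.comp_def, h]

theorem getLast?_rows_ne {n : ℕ} (G : SimpleGraph (Fin n)) :
    (List.ofFn (row G)).flatten.getLast? ≠ some (some true) := by
  cases n with
  | zero => simp
  | succ n => simp [List.ofFn_succ', -List.ofFn_succ, row, ← List.append_assoc]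

theorem polyTimeComputable_pad : PolyTimeComputable (pad e) :=
  polyTimeComputable (twinWord e) (adjWord e) _ (fun I => (List.ofFn (row I.G)).flatten)
    (fun I => getLast?_rows_ne I.G) (fun _ => rfl) fun I => by
      rw [count_none_rows, encode_pad]

theorem pad_mem_freeEdgeDeletion_iff {I : GraphInstance} : pad e I ∈ FreeEdgeDeletion H ↔
    ∃ F : Finset (Sym2 (Fin (I.n + (I.k + 1) * b))),
      (F : Set (Sym2 (Fin (I.n + (I.k + 1) * b)))) ⊆ (padGraph e I).edgeSet ∧ F.card ≤ I.k ∧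
        ¬ H.IsIndContained ((padGraph e I).deleteEdges F) :=
  Iff.rfl

/-- The edge in the padded graph corresponding to an edge of the given one. -/
def edgeEmbedding (n m : ℕ) : Sym2 (Fin n) ↪ Sym2 (Fin (n + m * b)) :=
  (Function.Embedding.inl.trans (vertexEquiv e n m).symm.toEmbedding).sym2Map

theorem edgeEmbedding_mk (n m : ℕ) (x y : Fin n) : edgeEmbedding e n m s(x, y) =
    s((vertexEquiv e n m).symm (.inl x), (vertexEquiv e n m).symm (.inl y)) :=
  rfl

theorem pad_mem_freeEdgeDeletion [Finite V]
    (hC₁ : ∀ C : H.ConnectedComponent, C.supp.ncard ≤ C₁.supp.ncard) {I : GraphInstance}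
    (hI : I ∈ FreeEdgeDeletion C₁.toSimpleGraph) : pad e I ∈ FreeEdgeDeletion H := by
  obtain ⟨F, hF, hk, hfree⟩ := hI
  let φ := vertexEquiv e I.n (I.k + 1)
  let ι := edgeEmbedding e I.n (I.k + 1)
  have hadj : ∀ x y, (padGraph e I).Adj (φ.symm x) (φ.symm y) ↔
      (I.G ⊕g blockGraph C₁ (I.k + 1)).Adj x y := fun x y =>
    padGraph_adj e (φ.apply_symm_apply x) (φ.apply_symm_apply y)
  refine (pad_mem_freeEdgeDeletion_iff e).2 ⟨F.map ι, ?_, by rwa [Finset.card_map], ?_⟩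
  · intro s hs
    obtain ⟨s, hsF, rfl⟩ := Finset.mem_map.1 (Finset.mem_coe.1 hs)
    induction s with | h x y =>
    exact (hadj (.inl x) (.inl y)).2 (sum_adj_inl.2 (I.G.mem_edgeSet.1 (hF hsF)))
  · rintro ⟨ψ⟩
    have hιl : ∀ x y, s(φ.symm (.inl x), φ.symm (.inl y)) ∈ F.map ι ↔ s(x, y) ∈ F := fun x y =>
      Finset.mem_map' ι (a := s(x, y))
    have hιr : ∀ x y, s(φ.symm (.inr x), φ.symm (.inr y)) ∉ F.map ι := by
      intro x y h
      obtain ⟨s, -, hs⟩ := Finset.mem_map.1 h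
      induction s with | h a c =>
      simp [ι, edgeEmbedding_mk, φ] at hs
    have hφ : ∀ x y, (I.G.deleteEdges F ⊕g blockGraph C₁ (I.k + 1)).Adj x y ↔
        ((padGraph e I).deleteEdges (F.map ι)).Adj (φ.symm x) (φ.symm y) := by
      intro x y
      rw [deleteEdges_adj, hadj, Finset.mem_coe]
      rcases x with x | x <;> rcases y with y | y
      · rw [hιl]
        simp
      · simp
      · simp
      · simp [hιr]
    refine not_isIndContained_sum_blockGraph (I.k + 1) hC₁ hfree
      ⟨ψ.trans (RelIso.symm (RelIso.mk φ.symm fun {x y} => ?_)).toRelEmbedding⟩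
    exact (hφ x y).symm

theorem mem_freeEdgeDeletion_of_pad {I : GraphInstance} (hI : pad e I ∈ FreeEdgeDeletion H) :
    I ∈ FreeEdgeDeletion C₁.toSimpleGraph := by
  classical
  obtain ⟨F, -, hk, hfree⟩ := (pad_mem_freeEdgeDeletion_iff e).1 hI
  let φ := vertexEquiv e I.n (I.k + 1)
  let ι := edgeEmbedding e I.n (I.k + 1)
  -- An edge determines the block in which it lies, so some block contains no edge of `F`.
  obtain ⟨i, hi⟩ : ∃ i, ∀ u v, s(φ.symm (.inr (i, u)), φ.symm (.inr (i, v))) ∉ F := by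
    by_contra! h
    choose u v h using h
    have hinj : Function.Injective fun i => (⟨_, h i⟩ : F) := fun i j hij => by
      rcases Sym2.eq_iff.1 (congrArg Subtype.val hij) with h | h
      · exact congrArg Prod.fst (Sum.inr_injective (φ.symm.injective h.1))
      · exact congrArg Prod.fst (Sum.inr_injective (φ.symm.injective h.1))
    have := Fintype.card_le_of_injective _ hinj
    simp only [Fintype.card_fin, Fintype.card_coe] at this
    omega
  let F₁ : Finset (Sym2 (Fin I.n)) := Finset.univ.filter fun s => s ∈ I.G.edgeSet ∧ ι s ∈ F
  have hF₁ : ∀ s, s ∈ F₁ ↔ s ∈ I.G.edgeSet ∧ ι s ∈ F := fun s => by simp [F₁]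
  refine ⟨F₁, fun s hs => ((hF₁ s).1 hs).1, ?_, fun h => hfree ?_⟩
  · exact (Finset.card_le_card_of_injOn ι (fun s hs => ((hF₁ s).1 hs).2) ι.injective.injOn).trans hk
  · let K := ((padGraph e I).deleteEdges F).comap φ.symm
    have hK : ∀ x y, K.Adj x y ↔ (I.G ⊕g blockGraph C₁ (I.k + 1)).Adj x y ∧
        s(φ.symm x, φ.symm y) ∉ F := fun x y => by
      change (((padGraph e I).deleteEdges F).Adj (φ.symm x) (φ.symm y)) ↔ _
      rw [deleteEdges_adj, padGraph_adj e (φ.apply_symm_apply x) (φ.apply_symm_apply y),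
        Finset.mem_coe]
    have hHK : H.IsIndContained K := by
      refine isIndContained_of_block h (fun x y => ?_) (fun x y => ?_) i fun u v => ?_
      · rw [hK, sum_adj_inl, deleteEdges_adj, Finset.mem_coe, hF₁, mem_edgeSet]
        simp +contextual only [true_and, ι, edgeEmbedding_mk, φ, and_congr_right_iff, implies_true]
      · simp [hK]
      · rw [hK, sum_adj_inr, blockGraph_adj_same]
        exact and_iff_left (hi u v)
    obtain ⟨ψ⟩ := hHK
    exact ⟨ψ.trans ⟨φ.symm.toEmbedding, Iff.rfl⟩⟩

end GraphInstance

theorem mainTheorem11 {V : Type*} [Finite V] (H : SimpleGraph V)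
    (hH : ∃ C : H.ConnectedComponent, 2 ≤ C.toSimpleGraph.edgeSet.ncard)
    (H₁ : H.ConnectedComponent)
    (hH₁ : ∀ C : H.ConnectedComponent, C.supp.ncard ≤ H₁.supp.ncard) :
    LinearParameterizedReduction (FreeEdgeDeletion H₁.toSimpleGraph) (FreeEdgeDeletion H) := by
  let e := Finite.equivFin ↥H₁.suppᶜ
  exact ⟨GraphInstance.pad e, GraphInstance.polyTimeComputable_pad e,
    fun I => ⟨GraphInstance.pad_mem_freeEdgeDeletion e hH₁,
      GraphInstance.mem_freeEdgeDeletion_of_pad e⟩, 1, fun I => (one_mul I.k).ge⟩
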